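/- Let $\mathbb{D}$ be the open unit disk, $\mathbb{T}$ the unit circle and $m$ normalized Lebesgue measure on $\mathbb{T}$. For $0<p<\infty$ let $H^p$ be the set of analytic functions $f$ on $\mathbb{D}$ with $\sup_{0<r<1}\int_{\mathbb{T}}|f(r\zeta)|^p\,dm(\zeta)<\infty$, and let $H^\infty$ be the set of bounded analytic functions on $\mathbb{D}$. An outer function is a function on $\mathbb{D}$ of the form $F(z)=e^{i\gamma}\exp\left(\int_{\mathbb{T}}\frac{\zeta+z}{\zeta-z}\log w(\zeta)\,dm(\zeta)\right)$ with $\gamma\in\mathbb{R}$, $w\ge 0$ on $\mathbb{T}$ and $\log w\in L^1(\mathbb{T},m)$. Let $\mathfrak{N}=\{f/g: f\in H^\infty,\ g\in H^\infty\setminus\{0\}\}$ and $N^+=\{f/g: f,g\in H^\infty,\ g\text{ outer}\}$. Let $\mathsf{R}$ be the set of $f\in\mathfrak{N}$ that are real valued a.e. on $\mathbb{T}$, that is, for $m$-almost every $\xi\in\mathbb{T}$ the radial limit $\lim_{r\to1^-}f(r\xi)$ exists and is a real number. Put $\mathsf{R}^+=\mathsf{R}\cap N^+$ and $\mathsf{R}^p=\mathsf{R}^+\cap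 H^p$. **Theorem 3.4.** If $1\le p\le\infty$, then $\mathsf{R}^p=\mathbb{R}$, that is, $\mathsf{R}^p$ is exactly the set of real constant functions on $\mathbb{D}$. -/

import Mathlib

/-!
Classes of functions on the open unit disk `ball 0 1` of `ℂ`. A function on the disk is represented
by a total function `ℂ → ℂ`; none of the classes below depends on its values off the disk.
The circle is parametrized by `θ ↦ circleMap 0 1 θ = exp (i θ)`, and the integral against
normalized Lebesgue measure on it is `Real.circleAverage · 0 1`.
-/

noncomputable section

namespace RealHardy

open Filter Topology Metric Set

/-- Bounded analytic functions on the unit disk. -/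
def HInfty : Set (ℂ → ℂ) :=
  {f | DifferentiableOn ℂ f (ball 0 1) ∧ ∃ C : ℝ, ∀ z ∈ ball (0 : ℂ) 1, ‖f z‖ ≤ C}

/-- The Hardy space `H^p` for `0 < p < ∞`: analytic functions on the unit disk such that the means
`∫ |f(rζ)|^p dm(ζ)`, `0 < r < 1`, are bounded. -/
def HFinite (p : ℝ) : Set (ℂ → ℂ) :=
  {f | DifferentiableOn ℂ f (ball 0 1) ∧
    ∃ C : ℝ, ∀ r ∈ Ioo (0 : ℝ) 1, Real.circleAverage (fun z => ‖f z‖ ^ p) 0 r ≤ C}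

open Classical in
/-- The Hardy space `H^p` for `0 < p ≤ ∞`. -/
def H (p : ENNReal) : Set (ℂ → ℂ) := if p = ⊤ then HInfty else HFinite p.toReal

/-- Outer functions: `e^{iγ} exp (∫ (ζ + z) / (ζ - z) log w(ζ) dm(ζ))` with `γ` real, `w ≥ 0` and
`log w` integrable. As `Real.log 0 = 0`, the condition `w > 0` a.e., which is part of the
integrability of `log w` when `log 0 = -∞`, is stated separately. -/
def Outer : Set (ℂ → ℂ) :=
  {F | ∃ (γ : ℝ) (w : ℂ → ℝ), (∀ ζ, 0 ≤ w ζ) ∧ (∀ᵐ θ : ℝ, 0 < w (circleMap 0 1 θ)) ∧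
    CircleIntegrable (fun ζ => Real.log (w ζ)) 0 1 ∧
    ∀ z ∈ ball (0 : ℂ) 1, F z = Complex.exp (γ * Complex.I) *
      Complex.exp (Real.circleAverage (fun ζ => (ζ + z) / (ζ - z) * (Real.log (w ζ) : ℂ)) 0 1)}

/-- Meromorphic functions of bounded type: quotients `u / v` of bounded analytic functions, `v` not
identically zero. A meromorphic function is represented with arbitrary values at the (isolated)
zeros of the denominator. -/
def BoundedType : Set (ℂ → ℂ) :=
  {f | ∃ u ∈ HInfty, ∃ v ∈ HInfty, (∃ z ∈ ball (0 : ℂ) 1, v z ≠ 0) ∧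
    ∀ z ∈ ball (0 : ℂ) 1, v z ≠ 0 → f z = u z / v z}

/-- The Smirnov class: quotients of bounded analytic functions with outer denominator (which has no
zeros in the disk). -/
def Smirnov : Set (ℂ → ℂ) :=
  {f | ∃ u ∈ HInfty, ∃ v ∈ HInfty ∩ Outer, ∀ z ∈ ball (0 : ℂ) 1, f z = u z / v z}

/-- For almost every `ζ` on the unit circle, `lim_{r → 1⁻} f(rζ)` exists and is a real number. -/
def RealBoundaryValues (f : ℂ → ℂ) : Prop :=
  ∀ᵐ θ : ℝ, ∃ x : ℝ, Tendsto (fun r : ℝ => f (r * circleMap 0 1 θ)) (𝓝[<] 1) (𝓝 (x : ℂ))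

/-- The real Nevanlinna class. -/
def R : Set (ℂ → ℂ) := {f | f ∈ BoundedType ∧ RealBoundaryValues f}

/-- The real Smirnov class. -/
def RPlus : Set (ℂ → ℂ) := R ∩ Smirnov

/-- The real `H^p` functions. -/
def RPow (p : ENNReal) : Set (ℂ → ℂ) := RPlus ∩ H p

/-- The functions that are equal on the unit disk to a real constant. -/
def RealConstants : Set (ℂ → ℂ) := {f | ∃ c : ℝ, ∀ z ∈ ball (0 : ℂ) 1, f z = (c : ℂ)}

end RealHardy

end

open Filter Topology Metric Set MeasureTheory Real

namespace RealHardy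

/-! For `p ≥ 1`, a function `f` in the class lies in `H^1`, so its radial boundary function `F` is
integrable by Fatou's lemma. If `f` is the Poisson integral of `F`, then `f` is real because `F` and
the kernel are real, and a real-valued analytic function on the disk is constant. The Poisson
representation comes from the Smirnov factorisation. Truncating the log modulus of the outer
denominator gives outer functions `h n`, bounded by `1`, with each `h n * f` bounded and `h n → 1`
on the disk (`exists_multipliers_of_mem_smirnov`). Boundedness permits the passage to the boundary
in `f` for fixed `n`. The factor `h n` is then removed using its convergence to `1` in L² on
circles, which follows from `h n 0 → 1` alone (`eq_integral_poissonKernel_of_multipliers`). No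
boundary values of `h n` are needed. -/

/-- The restriction of Lebesgue measure to one period of `θ ↦ circleMap 0 1 θ`. -/
noncomputable abbrev periodMeasure : Measure ℝ := volume.restrict (Ioc 0 (2 * π))

/-! ### Circle integrals, dilations and the Poisson kernel. -/

theorem circleAverage_eq_integral_periodMeasure {E : Type*} [NormedAddCommGroup E]
    [NormedSpace ℝ E] (f : ℂ → E) (r : ℝ) :
    circleAverage f 0 r = (2 * π)⁻¹ • ∫ θ, f (circleMap 0 r θ) ∂periodMeasure := by
  rw [circleAverage_def, intervalIntegral.integral_of_le two_pi_pos.le]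

theorem circleIntegrable_iff_integrable_periodMeasure {E : Type*} [NormedAddCommGroup E]
    (f : ℂ → E) (r : ℝ) :
    CircleIntegrable f 0 r ↔ Integrable (fun θ => f (circleMap 0 r θ)) periodMeasure := by
  rw [CircleIntegrable, intervalIntegrable_iff_integrableOn_Ioc_of_le two_pi_pos.le,
    IntegrableOn]

theorem ofReal_mul_mem_ball {r : ℝ} (hr : r ∈ Ioo (0 : ℝ) 1) {z : ℂ} (hz : ‖z‖ ≤ 1) :
    (r : ℂ) * z ∈ ball (0 : ℂ) 1 := by
  rw [mem_ball_zero_iff, norm_mul, Complex.norm_real, norm_of_nonneg hr.1.le]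
  nlinarith [hr.1, hr.2, norm_nonneg z]

theorem ofReal_mul_circleMap_mem_ball {r : ℝ} (hr : r ∈ Ioo (0 : ℝ) 1) (θ : ℝ) :
    (r : ℂ) * circleMap 0 1 θ ∈ ball (0 : ℂ) 1 :=
  ofReal_mul_mem_ball hr (by simp)

theorem diffContOnCl_dilation {g : ℂ → ℂ} (hg : DifferentiableOn ℂ g (ball 0 1)) {r : ℝ}
    (hr : r ∈ Ioo (0 : ℝ) 1) : DiffContOnCl ℂ (fun z => g (r * z)) (ball 0 1) := by
  apply DifferentiableOn.diffContOnCl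
  rw [closure_ball (0 : ℂ) one_ne_zero]
  exact hg.comp (by fun_prop) fun z hz => ofReal_mul_mem_ball hr (by simpa using hz)

theorem continuous_dilation_circleMap {g : ℂ → ℂ} (hg : DifferentiableOn ℂ g (ball 0 1)) {r : ℝ}
    (hr : r ∈ Ioo (0 : ℝ) 1) : Continuous fun θ : ℝ => g (r * circleMap 0 1 θ) :=
  hg.continuousOn.comp_continuous (by fun_prop) (ofReal_mul_circleMap_mem_ball hr)

theorem continuousOn_poissonKernel_sphere {z : ℂ} (hz : z ∈ ball (0 : ℂ) 1) :
    ContinuousOn (poissonKernel 0 z) (sphere 0 1) := by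
  rw [poissonKernel_eq_re_herglotzRieszKernel]
  have h := continuousOn_herglotzRieszKernel_sphere hz
  rw [abs_one] at h
  exact Complex.continuous_re.comp_continuousOn h

theorem continuous_poissonKernel_circleMap {z : ℂ} (hz : z ∈ ball (0 : ℂ) 1) :
    Continuous fun θ : ℝ => poissonKernel 0 z (circleMap 0 1 θ) :=
  (continuousOn_poissonKernel_sphere hz).comp_continuous (continuous_circleMap 0 1)
    (circleMap_mem_sphere 0 zero_le_one)

theorem exists_norm_poissonKernel_circleMap_le {z : ℂ} (hz : z ∈ ball (0 : ℂ) 1) :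
    ∃ K, ∀ θ : ℝ, ‖poissonKernel 0 z (circleMap 0 1 θ)‖ ≤ K := by
  obtain ⟨K, hK⟩ := (isCompact_sphere (0 : ℂ) 1).exists_bound_of_continuousOn
    (continuousOn_poissonKernel_sphere hz)
  exact ⟨K, fun θ => hK _ (circleMap_mem_sphere 0 zero_le_one θ)⟩

theorem poissonKernel_nonneg {z ζ : ℂ} (hz : z ∈ ball (0 : ℂ) 1) (hζ : ζ ∈ sphere (0 : ℂ) 1) :
    0 ≤ poissonKernel 0 z ζ := by
  have h : ‖z‖ < 1 := by simpa using hz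
  have h' : ‖ζ‖ = 1 := by simpa using hζ
  rw [poissonKernel_def, sub_zero, sub_zero, h']
  have := norm_nonneg z
  exact div_nonneg (by nlinarith) (by positivity)

theorem integral_poissonKernel_dilation {g : ℂ → ℂ} (hg : DifferentiableOn ℂ g (ball 0 1)) {r : ℝ}
    (hr : r ∈ Ioo (0 : ℝ) 1) {z : ℂ} (hz : z ∈ ball (0 : ℂ) 1) :
    (2 * π)⁻¹ • ∫ θ, poissonKernel 0 z (circleMap 0 1 θ) • g (r * circleMap 0 1 θ) ∂periodMeasure
      = g (r * z) := by
  have h := (diffContOnCl_dilation hg hr).circleAverage_poissonKernel_smul hz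
  rwa [circleAverage_eq_integral_periodMeasure] at h

/-! ### Removing multipliers that tend to `1`. -/

/-- Since `|h| ≤ 1`, expanding the square gives `|h - 1|² ≤ 2 - 2 Re h`, and the mean value property
integrates the right side. Thus control at the origin alone yields L² control on every circle. -/
theorem integral_norm_sub_one_sq_le {h : ℂ → ℂ} (hd : DifferentiableOn ℂ h (ball 0 1))
    (hle : ∀ z ∈ ball (0 : ℂ) 1, ‖h z‖ ≤ 1) {r : ℝ} (hr : r ∈ Ioo (0 : ℝ) 1) :
    ∫ θ, ‖h (r * circleMap 0 1 θ) - 1‖ ^ 2 ∂periodMeasure ≤ (2 * π) * (2 - 2 * (h 0).re) := by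
  have hc := continuous_dilation_circleMap hd hr
  have hmean : ∫ θ, h (r * circleMap 0 1 θ) ∂periodMeasure = (2 * π : ℝ) • h 0 := by
    have h1 := DiffContOnCl.circleAverage (c := 0) (R := 1) (f := fun z => h (r * z))
      (by simpa using diffContOnCl_dilation hd hr)
    rw [circleAverage_eq_integral_periodMeasure, mul_zero] at h1
    rw [← h1, smul_inv_smul₀ two_pi_pos.ne']
  have hint : Integrable (fun θ => h (r * circleMap 0 1 θ)) periodMeasure :=
    hc.integrableOn_Ioc
  have hre : ∫ θ, (h (r * circleMap 0 1 θ)).re ∂periodMeasure = 2 * π * (h 0).re := by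
    have := integral_re hint
    simp only [RCLike.re_eq_complex_re] at this
    rw [this, hmean]; simp
  calc ∫ θ, ‖h (r * circleMap 0 1 θ) - 1‖ ^ 2 ∂periodMeasure
      ≤ ∫ θ, (2 - 2 * (h (r * circleMap 0 1 θ)).re) ∂periodMeasure := by
        refine integral_mono ((hc.sub continuous_const).norm.pow 2).integrableOn_Ioc
          (continuous_const.sub ((Complex.continuous_re.comp hc).const_mul 2)).integrableOn_Ioc
          fun θ => ?_
        have h1 := hle _ (ofReal_mul_circleMap_mem_ball hr θ)
        have h2 : ‖h (r * circleMap 0 1 θ)‖ ^ 2 ≤ 1 := pow_le_one₀ (norm_nonneg _) h1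
        simp only [← Complex.normSq_eq_norm_sq, Complex.normSq_apply, Complex.sub_re,
          Complex.sub_im, Complex.one_re, Complex.one_im] at h2 ⊢
        linarith
    _ = (2 * π) * (2 - 2 * (h 0).re) := by
        have hint' : Integrable (fun θ => 2 * (h (r * circleMap 0 1 θ)).re) periodMeasure :=
          ((Complex.continuous_re.comp hc).const_mul 2).integrableOn_Ioc
        rw [integral_sub (integrable_const _) hint', integral_const_mul, hre, integral_const]
        simp only [measureReal_restrict_apply_univ, volume_real_Ioc_of_le two_pi_pos.le, smul_eq_mul]
        ring

/-- The hypothesis gives convergence in measure, hence a.e. along a subsequence, and `|G|`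
dominates. A subsequence suffices where the full sequence is already known to converge. -/
theorem exists_subseq_tendsto_integral_smul {α : Type*} [MeasurableSpace α] {μ : Measure α}
    [IsFiniteMeasure μ] {G : α → ℂ} (hG : Integrable G μ) {h : ℕ → α → ℂ}
    (hm : ∀ n, AEStronglyMeasurable (h n) μ) (hle : ∀ n x, ‖h n x‖ ≤ 1)
    (ht : Tendsto (fun n => ∫ x, ‖h n x - 1‖ ^ 2 ∂μ) atTop (𝓝 0)) :
    ∃ s : ℕ → ℕ, StrictMono s ∧
      Tendsto (fun k => ∫ x, h (s k) x * G x ∂μ) atTop (𝓝 (∫ x, G x ∂μ)) := by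
  have hm' : ∀ n, AEStronglyMeasurable (fun x => ‖h n x - 1‖ ^ 2) μ := fun n =>
    ((hm n).sub aestronglyMeasurable_const).norm.pow 2
  have hi : ∀ n, Integrable (fun x => ‖h n x - 1‖ ^ 2) μ := fun n =>
    Integrable.of_bound (hm' n) 4 <| .of_forall fun x => by
      have h1 : ‖h n x - 1‖ ≤ 2 := (norm_sub_le _ _).trans (by simpa using by linarith [hle n x])
      rw [norm_pow, norm_norm]
      nlinarith [norm_nonneg (h n x - 1)]
  have hmeas : TendstoInMeasure μ (fun n x => ‖h n x - 1‖ ^ 2) atTop (fun _ => (0 : ℝ)) := by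
    refine tendstoInMeasure_of_tendsto_eLpNorm one_ne_zero hm' aestronglyMeasurable_const ?_
    have h1 : ∀ n, eLpNorm ((fun x => ‖h n x - 1‖ ^ 2) - fun _ => (0 : ℝ)) 1 μ
        = ENNReal.ofReal (∫ x, ‖h n x - 1‖ ^ 2 ∂μ) := fun n => by
      rw [eLpNorm_one_eq_lintegral_enorm, ← ofReal_integral_norm_eq_lintegral_enorm]
      · simp
      · simpa [Pi.sub_def] using hi n
    simp_rw [h1]
    simpa using ENNReal.tendsto_ofReal ht
  obtain ⟨s, hs, hae⟩ := hmeas.exists_seq_tendsto_ae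
  refine ⟨s, hs, tendsto_integral_of_dominated_convergence (fun x => ‖G x‖)
    (fun k => (hm (s k)).mul hG.1) hG.norm (fun k => .of_forall fun x => ?_) ?_⟩
  · rw [norm_mul]
    exact mul_le_of_le_one_left (norm_nonneg _) (hle _ _)
  · filter_upwards [hae] with x hx
    have h1 : Tendsto (fun k => ‖h (s k) x - 1‖) atTop (𝓝 0) := by
      have := hx.sqrt
      simpa [Real.sqrt_sq] using this
    simpa using ((tendsto_iff_norm_sub_tendsto_zero.2 h1).mul_const (G x))

/-! ### Poisson representation by boundary values. -/

/-- Only the factor `f` is moved to the boundary; `h` stays on the circle of radius `r`, so it needs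
no radial limits. -/
theorem tendsto_integral_poissonKernel_mul_boundary {f h : ℂ → ℂ} {F : ℝ → ℂ}
    (hf : DifferentiableOn ℂ f (ball 0 1))
    (hlim : ∀ᵐ θ ∂periodMeasure,
      Tendsto (fun r : ℝ => f (r * circleMap 0 1 θ)) (𝓝[<] 1) (𝓝 (F θ)))
    (hF : Integrable F periodMeasure) (hh : DifferentiableOn ℂ h (ball 0 1))
    (hle : ∀ z ∈ ball (0 : ℂ) 1, ‖h z‖ ≤ 1) {C : ℝ}
    (hC : ∀ z ∈ ball (0 : ℂ) 1, ‖h z * f z‖ ≤ C) {z : ℂ} (hz : z ∈ ball (0 : ℂ) 1) :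
    Tendsto (fun r : ℝ => (2 * π)⁻¹ • ∫ θ, h (r * circleMap 0 1 θ) *
      (poissonKernel 0 z (circleMap 0 1 θ) • F θ) ∂periodMeasure) (𝓝[<] 1) (𝓝 (h z * f z)) := by
  obtain ⟨K, hK⟩ := exists_norm_poissonKernel_circleMap_le hz
  have hP := continuous_poissonKernel_circleMap hz
  have hr1 : ∀ᶠ r : ℝ in 𝓝[<] 1, r ∈ Ioo (0 : ℝ) 1 := Ioo_mem_nhdsLT one_pos
  have hhf : DifferentiableOn ℂ (fun z => h z * f z) (ball 0 1) := hh.mul hf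
  have hdiff : Tendsto (fun r : ℝ => (2 * π)⁻¹ • ∫ θ, (poissonKernel 0 z (circleMap 0 1 θ) •
      (h (r * circleMap 0 1 θ) * (f (r * circleMap 0 1 θ) - F θ))) ∂periodMeasure)
      (𝓝[<] 1) (𝓝 0) := by
    suffices hzero : Tendsto (fun r : ℝ => ∫ θ, (poissonKernel 0 z (circleMap 0 1 θ) •
        (h (r * circleMap 0 1 θ) * (f (r * circleMap 0 1 θ) - F θ))) ∂periodMeasure)
        (𝓝[<] 1) (𝓝 (∫ _, (0 : ℂ) ∂periodMeasure)) by
      simpa using hzero.const_smul ((2 * π)⁻¹ : ℝ)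
    -- No radial majorant of `f` is at hand, but `h * f` is bounded by `C` and `|h| ≤ 1`, so `h * (f
    -- - F)` is dominated by `C + |F|`.
    refine tendsto_integral_filter_of_dominated_convergence (fun θ => K * (C + ‖F θ‖)) ?_ ?_
      (((integrable_const C).add hF.norm).const_mul K) ?_
    · filter_upwards [hr1] with r hr
      exact hP.aestronglyMeasurable.smul ((continuous_dilation_circleMap hh
        hr).aestronglyMeasurable.mul ((continuous_dilation_circleMap hf
        hr).aestronglyMeasurable.sub hF.1))
    · filter_upwards [hr1] with r hr
      refine .of_forall fun θ => ?_
      have hmem := ofReal_mul_circleMap_mem_ball hr θ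
      rw [norm_smul]
      refine mul_le_mul (hK θ) ?_ (norm_nonneg _) ((norm_nonneg _).trans (hK θ))
      rw [mul_sub]
      refine (norm_sub_le _ _).trans (add_le_add (hC _ hmem) ?_)
      rw [norm_mul]
      exact mul_le_of_le_one_left (norm_nonneg _) (hle _ hmem)
    · filter_upwards [hlim] with θ hθ
      rw [tendsto_zero_iff_norm_tendsto_zero]
      refine squeeze_zero' (g := fun r : ℝ => K * ‖f (r * circleMap 0 1 θ) - F θ‖)
        (.of_forall fun _ => norm_nonneg _) ?_ ?_
      · filter_upwards [hr1] with r hr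
        rw [norm_smul, norm_mul]
        exact mul_le_mul (hK θ) (mul_le_of_le_one_left (norm_nonneg _)
          (hle _ (ofReal_mul_circleMap_mem_ball hr θ))) (by positivity)
          ((norm_nonneg _).trans (hK θ))
      · simpa using (tendsto_iff_norm_sub_tendsto_zero.1 hθ).const_mul K
  have hcont : Tendsto (fun r : ℝ => h (r * z) * f (r * z)) (𝓝[<] 1) (𝓝 (h z * f z)) := by
    have h1 : ContinuousAt (fun z => h z * f z) z :=
      hhf.continuousOn.continuousAt (isOpen_ball.mem_nhds hz)
    have h2 : Tendsto (fun r : ℝ => (r : ℂ) * z) (𝓝[<] 1) (𝓝 z) := by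
      have : Continuous fun r : ℝ => (r : ℂ) * z := by fun_prop
      simpa using (this.tendsto 1).mono_left nhdsWithin_le_nhds
    exact h1.tendsto.comp h2
  have h3 := hcont.sub hdiff
  rw [sub_zero] at h3
  refine h3.congr' ?_
  filter_upwards [hr1] with r hr
  have h4 := integral_poissonKernel_dilation hhf hr hz
  rw [← h4, ← smul_sub, ← integral_sub]
  · congr 1
    refine integral_congr_ae (.of_forall fun θ => ?_)
    simp only [Complex.real_smul]
    ring
  · exact (hP.smul (continuous_dilation_circleMap hhf hr)).integrableOn_Ioc
  · have h5 : Integrable (fun θ => h (r * circleMap 0 1 θ) * F θ) periodMeasure :=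
      hF.bdd_mul (continuous_dilation_circleMap hh hr).aestronglyMeasurable
        (.of_forall fun θ => hle _ (ofReal_mul_circleMap_mem_ball hr θ))
    have h6 := ((continuous_dilation_circleMap hhf hr).integrableOn_Ioc (μ := volume)
      (a := 0) (b := 2 * π)).sub h5
    refine Integrable.bdd_smul (?_ : Integrable _ _) K
      hP.aestronglyMeasurable (.of_forall hK)
    refine h6.congr (.of_forall fun θ => ?_)
    simp only [Pi.sub_apply]
    ring

/-- Poisson representation of `f` by its boundary values `F`, given bounded multipliers `h n → 1`
such that each `h n * f` is bounded. -/
theorem eq_integral_poissonKernel_of_multipliers {f : ℂ → ℂ} {h : ℕ → ℂ → ℂ} {F : ℝ → ℂ}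
    (hf : DifferentiableOn ℂ f (ball 0 1))
    (hlim : ∀ᵐ θ ∂periodMeasure,
      Tendsto (fun r : ℝ => f (r * circleMap 0 1 θ)) (𝓝[<] 1) (𝓝 (F θ)))
    (hF : Integrable F periodMeasure) (hh : ∀ n, DifferentiableOn ℂ (h n) (ball 0 1))
    (hle : ∀ n, ∀ z ∈ ball (0 : ℂ) 1, ‖h n z‖ ≤ 1)
    (hC : ∀ n, ∃ C : ℝ, ∀ z ∈ ball (0 : ℂ) 1, ‖h n z * f z‖ ≤ C)
    (ht : ∀ z ∈ ball (0 : ℂ) 1, Tendsto (fun n => h n z) atTop (𝓝 1))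
    {z : ℂ} (hz : z ∈ ball (0 : ℂ) 1) :
    f z = (2 * π)⁻¹ • ∫ θ, poissonKernel 0 z (circleMap 0 1 θ) • F θ ∂periodMeasure := by
  obtain ⟨K, hK⟩ := exists_norm_poissonKernel_circleMap_le hz
  have hP := continuous_poissonKernel_circleMap hz
  have hPF : Integrable (fun θ => poissonKernel 0 z (circleMap 0 1 θ) • F θ) periodMeasure :=
    hF.bdd_smul K hP.aestronglyMeasurable (.of_forall hK)
  -- Diagonal choice: a radius `r n < 1` for each `n` replaces the missing boundary function of `h
  -- n`.
  have hex : ∀ n : ℕ, ∃ r ∈ Ioo (0 : ℝ) 1, dist ((2 * π)⁻¹ • ∫ θ, h n (r * circleMap 0 1 θ) *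
      (poissonKernel 0 z (circleMap 0 1 θ) • F θ) ∂periodMeasure) (h n z * f z)
      < 1 / ((n : ℝ) + 1) := fun n => by
    obtain ⟨C, hC⟩ := hC n
    have h1 := (tendsto_integral_poissonKernel_mul_boundary hf hlim hF (hh n) (hle n) hC hz)
      (ball_mem_nhds _ (Nat.one_div_pos_of_nat (α := ℝ) (n := n)))
    have h2 : ∀ᶠ r : ℝ in 𝓝[<] 1, r ∈ Ioo (0 : ℝ) 1 := Ioo_mem_nhdsLT one_pos
    obtain ⟨r, hr1, hr2⟩ := (h2.and h1).exists
    exact ⟨r, hr1, hr2⟩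
  choose r hr hdist using hex
  have hlim1 : Tendsto (fun n => (2 * π)⁻¹ • ∫ θ, h n (r n * circleMap 0 1 θ) *
      (poissonKernel 0 z (circleMap 0 1 θ) • F θ) ∂periodMeasure) atTop (𝓝 (f z)) := by
    have h1 : Tendsto (fun n => h n z * f z) atTop (𝓝 (f z)) := by
      simpa using (ht z hz).mul_const (f z)
    refine h1.congr_dist ?_
    simp_rw [dist_comm (h _ z * f z)]
    exact squeeze_zero (fun _ => dist_nonneg) (fun n => (hdist n).le)
      tendsto_one_div_add_atTop_nhds_zero_nat
  have hzero : Tendsto (fun n => ∫ θ, ‖h n (r n * circleMap 0 1 θ) - 1‖ ^ 2 ∂periodMeasure) atTop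
      (𝓝 0) := by
    refine squeeze_zero (fun n => integral_nonneg fun θ => by positivity)
      (fun n => integral_norm_sub_one_sq_le (hh n) (hle n) (hr n)) ?_
    have h1 := (Complex.continuous_re.tendsto _).comp (ht 0 (mem_ball_self one_pos))
    have h2 := ((h1.const_mul 2).const_sub 2).const_mul (2 * π)
    simpa using h2
  obtain ⟨s, hs, hs'⟩ := exists_subseq_tendsto_integral_smul hPF
    (fun n => (continuous_dilation_circleMap (hh n) (hr n)).aestronglyMeasurable)
    (fun n θ => hle n _ (ofReal_mul_circleMap_mem_ball (hr n) θ)) hzero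
  exact tendsto_nhds_unique (hlim1.comp hs.tendsto_atTop) (hs'.const_smul _)

/-! ### Outer functions and the Smirnov multipliers. -/

/-- The outer function with boundary modulus `exp φ` that is positive at `0`. -/
noncomputable def outerExp (φ : ℂ → ℝ) (z : ℂ) : ℂ :=
  Complex.exp (circleAverage (fun ζ => (ζ + z) / (ζ - z) * (φ ζ : ℂ)) 0 1)

theorem outerExp_eq (φ : ℂ → ℝ) (z : ℂ) :
    outerExp φ z
      = Complex.exp (circleAverage (fun ζ => herglotzRieszKernel 0 z ζ • (φ ζ : ℂ)) 0 1) := by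
  simp [outerExp, herglotzRieszKernel_def]

theorem circleIntegrable_ofReal {φ : ℂ → ℝ} (hφ : CircleIntegrable φ 0 1) :
    CircleIntegrable (fun ζ => (φ ζ : ℂ)) 0 1 := by
  rw [circleIntegrable_iff_integrable_periodMeasure] at hφ ⊢
  exact hφ.ofReal

theorem circleIntegrable_herglotzRieszKernel_smul {φ : ℂ → ℝ} (hφ : CircleIntegrable φ 0 1)
    {z : ℂ} (hz : z ∈ ball (0 : ℂ) 1) :
    CircleIntegrable (fun ζ => herglotzRieszKernel 0 z ζ • (φ ζ : ℂ)) 0 1 :=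
  (circleIntegrable_ofReal hφ).continuousOn_smul (continuousOn_herglotzRieszKernel_sphere hz)

theorem differentiableOn_outerExp {φ : ℂ → ℝ} (hφ : CircleIntegrable φ 0 1) :
    DifferentiableOn ℂ (outerExp φ) (ball 0 1) := by
  rw [funext (outerExp_eq φ)]
  exact (differentiableOn_circleAverage_herglotzRieszKernel_smul
    (circleIntegrable_ofReal hφ)).cexp

theorem outerExp_eq_mul_outerExp_sub {φ ψ : ℂ → ℝ} (hφ : CircleIntegrable φ 0 1)
    (hψ : CircleIntegrable ψ 0 1) {z : ℂ} (hz : z ∈ ball (0 : ℂ) 1) :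
    outerExp φ z = outerExp ψ z * outerExp (φ - ψ) z := by
  simp only [outerExp_eq]
  rw [← Complex.exp_add, ← circleAverage_fun_add
    (circleIntegrable_herglotzRieszKernel_smul hψ hz)
    (circleIntegrable_herglotzRieszKernel_smul (hφ.sub hψ) hz)]
  simp [mul_sub]

/-- The log modulus of `outerExp φ` is the Poisson integral of `φ`, and the kernel is nonnegative
with mean `1`. -/
theorem norm_outerExp_le {φ : ℂ → ℝ} (hφ : CircleIntegrable φ 0 1) {c : ℝ}
    (hc : ∀ ζ ∈ sphere (0 : ℂ) 1, φ ζ ≤ c) {z : ℂ} (hz : z ∈ ball (0 : ℂ) 1) :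
    ‖outerExp φ z‖ ≤ Real.exp c := by
  rw [outerExp_eq, Complex.norm_exp, re_circleAverage_herglotzRieszKernel_smul hφ hz,
    ← poissonKernel_eq_re_herglotzRieszKernel, Real.exp_le_exp]
  have hP : ContinuousOn (poissonKernel 0 z) (sphere 0 |1|) := by
    simpa using continuousOn_poissonKernel_sphere hz
  have hone : circleAverage (poissonKernel 0 z • fun _ => c) 0 1 = c :=
    InnerProductSpace.HarmonicContOnCl.circleAverage_poissonKernel_smul (f := fun _ => c)
      InnerProductSpace.harmonicContOnCl_const hz
  rw [← hone]
  refine circleAverage_mono (hφ.continuousOn_smul hP)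
    ((circleIntegrable_const c 0 1).continuousOn_smul hP) fun ζ hζ => ?_
  rw [abs_one] at hζ
  exact mul_le_mul_of_nonneg_left (hc ζ hζ) (poissonKernel_nonneg hz hζ)

theorem circleIntegrable_min_zero_add {φ : ℂ → ℝ} (hφ : CircleIntegrable φ 0 1) (c : ℝ) :
    CircleIntegrable (fun ζ => min 0 (c + φ ζ)) 0 1 := by
  rw [circleIntegrable_iff_integrable_periodMeasure] at hφ ⊢
  exact (integrable_zero _ _ _).inf ((integrable_const c).add hφ)

/-- At each point `min 0 (n + φ)` is eventually `0`, and its absolute value never exceeds `|φ|`, so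
dominated convergence sends the exponent to `0`. -/
theorem tendsto_outerExp_min_zero_add {φ : ℂ → ℝ} (hφ : CircleIntegrable φ 0 1)
    {z : ℂ} (hz : z ∈ ball (0 : ℂ) 1) :
    Tendsto (fun n : ℕ => outerExp (fun ζ => min 0 (n + φ ζ)) z) atTop (𝓝 1) := by
  simp only [outerExp_eq, circleAverage_eq_integral_periodMeasure]
  obtain ⟨K, hK⟩ := (isCompact_sphere (0 : ℂ) 1).exists_bound_of_continuousOn
    (by simpa using continuousOn_herglotzRieszKernel_sphere hz :
      ContinuousOn (herglotzRieszKernel 0 z) (sphere 0 1))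
  have hφ' := (circleIntegrable_iff_integrable_periodMeasure _ _).1 hφ
  have h1 : Tendsto (fun n : ℕ => ∫ θ, herglotzRieszKernel 0 z (circleMap 0 1 θ) •
      ((min 0 (n + φ (circleMap 0 1 θ)) : ℝ) : ℂ) ∂periodMeasure) atTop
      (𝓝 (∫ _, (0 : ℂ) ∂periodMeasure)) := by
    refine tendsto_integral_of_dominated_convergence (fun θ => K * ‖φ (circleMap 0 1 θ)‖)
      (fun n => ((circleIntegrable_iff_integrable_periodMeasure _ _).1
        (circleIntegrable_herglotzRieszKernel_smul
          (circleIntegrable_min_zero_add hφ n) hz)).aestronglyMeasurable)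
      (hφ'.norm.const_mul K) (fun n => .of_forall fun θ => ?_) (.of_forall fun θ => ?_)
    · rw [norm_smul, Complex.norm_real]
      refine mul_le_mul (hK _ (circleMap_mem_sphere 0 zero_le_one θ)) ?_ (norm_nonneg _)
        ((norm_nonneg _).trans (hK _ (circleMap_mem_sphere 0 zero_le_one θ)))
      have hn : (0 : ℝ) ≤ n := n.cast_nonneg
      rw [norm_eq_abs, norm_eq_abs, abs_of_nonpos (min_le_left _ _)]
      rcases min_cases 0 ((n : ℝ) + φ (circleMap 0 1 θ)) with h | h <;> rw [h.1]
      · simp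
      · linarith [neg_le_abs (φ (circleMap 0 1 θ))]
    · refine tendsto_const_nhds.congr' ?_
      obtain ⟨N, hN⟩ := exists_nat_ge (-φ (circleMap 0 1 θ))
      filter_upwards [eventually_ge_atTop N] with n hn
      have : (N : ℝ) ≤ n := by exact_mod_cast hn
      rw [min_eq_left (by linarith)]
      simp
  simpa [Function.comp_def] using ((Complex.continuous_exp.tendsto _).comp (h1.const_smul ((2 * π)⁻¹ : ℝ)))

/-- A function of the Smirnov class has bounded analytic multipliers, converging to `1` on the disk,
that make it bounded. -/
theorem exists_multipliers_of_mem_smirnov {f : ℂ → ℂ} (hf : f ∈ Smirnov) :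
    ∃ h : ℕ → ℂ → ℂ, (∀ n, DifferentiableOn ℂ (h n) (ball 0 1)) ∧
      (∀ n, ∀ z ∈ ball (0 : ℂ) 1, ‖h n z‖ ≤ 1) ∧
      (∀ n, ∃ C : ℝ, ∀ z ∈ ball (0 : ℂ) 1, ‖h n z * f z‖ ≤ C) ∧
      ∀ z ∈ ball (0 : ℂ) 1, Tendsto (fun n => h n z) atTop (𝓝 1) := by
  obtain ⟨u, ⟨-, B, hB⟩, v, ⟨-, γ, w, -, -, hw, hv⟩, hfv⟩ := hf
  -- The intended boundary modulus is `min 1 (exp n * w)`: at most `1`, at most a multiple of `|v|`,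
  -- and increasing to `1` where `w > 0`.
  refine ⟨fun n => outerExp fun ζ => min 0 (n + Real.log (w ζ)),
    fun n => differentiableOn_outerExp (circleIntegrable_min_zero_add hw n), fun n z hz => ?_,
    fun n => ⟨Real.exp n * B, fun z hz => ?_⟩, fun z hz => tendsto_outerExp_min_zero_add hw hz⟩
  · simpa using norm_outerExp_le (circleIntegrable_min_zero_add hw n)
      (fun ζ _ => min_le_left 0 ((n : ℝ) + Real.log (w ζ))) hz
  · have hv' : v z = Complex.exp (γ * Complex.I) * outerExp (fun ζ => Real.log (w ζ)) z := hv z hz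
    have hne : outerExp (fun ζ => Real.log (w ζ)) z ≠ 0 := Complex.exp_ne_zero _
    have hn : ‖Complex.exp (γ * Complex.I)‖ = 1 := Complex.norm_exp_ofReal_mul_I γ
    have hi := circleIntegrable_min_zero_add hw n
    -- Up to a unimodular constant, `h n / v` is outer with log modulus `min 0 (n + log w) - log w ≤
    -- n`; this is the source of the factor `exp n`.
    have hle := norm_outerExp_le (hi.sub hw) (c := n)
      (fun ζ _ => sub_le_iff_le_add.2 (min_le_right _ _)) hz
    beta_reduce
    rw [outerExp_eq_mul_outerExp_sub hi hw hz, hfv z hz, hv', norm_mul, norm_div, norm_mul, norm_mul,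
      hn, one_mul]
    have hpos := norm_pos_iff.2 hne
    rw [mul_comm ‖outerExp (fun ζ => Real.log (w ζ)) z‖, mul_assoc, mul_div_cancel₀ _ hpos.ne']
    exact mul_le_mul hle (hB z hz) (norm_nonneg _) (Real.exp_nonneg _)

/-! ### Reduction to `H^1` and integrability of the boundary function. -/

theorem continuousOn_sphere_of_differentiableOn_ball {f : ℂ → ℂ}
    (hf : DifferentiableOn ℂ f (ball 0 1)) {r : ℝ} (hr : r ∈ Ioo (0 : ℝ) 1) :
    ContinuousOn f (sphere 0 |r|) :=
  hf.continuousOn.mono (sphere_subset_ball (by rw [abs_of_pos hr.1]; exact hr.2))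

/-- `H^p ⊆ H^1` for `p ≥ 1`. -/
theorem mem_HFinite_one_of_mem_H {p : ENNReal} (hp : 1 ≤ p) {f : ℂ → ℂ} (hf : f ∈ H p) :
    f ∈ HFinite 1 := by
  unfold H at hf
  split_ifs at hf with htop
  · obtain ⟨hd, C, hC⟩ := hf
    refine ⟨hd, C, fun r hr => ?_⟩
    have hc := continuousOn_sphere_of_differentiableOn_ball hd hr
    refine circleAverage_mono_on_of_le_circle ?_ fun z hz => ?_
    · simpa using hc.norm.circleIntegrable'
    · rw [Real.rpow_one]
      exact hC z (sphere_subset_ball (by rw [abs_of_pos hr.1]; exact hr.2) hz)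
  · obtain ⟨hd, C, hC⟩ := hf
    have hp1 : 1 ≤ p.toReal := by
      simpa using (ENNReal.toReal_le_toReal ENNReal.one_ne_top htop).2 hp
    -- The bound comes from `t ≤ 1 + t ^ p` for `t ≥ 0` and `p ≥ 1`.
    refine ⟨hd, 1 + C, fun r hr => ?_⟩
    have hc := continuousOn_sphere_of_differentiableOn_ball hd hr
    have hi : CircleIntegrable (fun z => ‖f z‖ ^ p.toReal) 0 r :=
      (hc.norm.rpow_const fun z _ => .inr (by linarith)).circleIntegrable'
    have h1 : CircleIntegrable (fun _ => (1 : ℝ)) 0 r := circleIntegrable_const 1 0 r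
    calc circleAverage (fun z => ‖f z‖ ^ (1 : ℝ)) 0 r
        ≤ circleAverage (fun z => 1 + ‖f z‖ ^ p.toReal) 0 r := by
          refine circleAverage_mono (by simpa using hc.norm.circleIntegrable') (h1.add hi)
            fun z _ => ?_
          rcases le_total ‖f z‖ 1 with h | h
          · rw [Real.rpow_one]
            linarith [Real.rpow_nonneg (norm_nonneg (f z)) p.toReal]
          · linarith [Real.rpow_le_rpow_of_exponent_le h hp1]
      _ = 1 + circleAverage (fun z => ‖f z‖ ^ p.toReal) 0 r := by
          rw [circleAverage_fun_add h1 hi, circleAverage_const]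
      _ ≤ 1 + C := by linarith [hC r hr]

/-- Fatou's lemma along radii increasing to `1`; the same sequence gives measurability of `F`. -/
theorem integrable_boundary_of_mem_HFinite_one {f : ℂ → ℂ} (hf : f ∈ HFinite 1) {F : ℝ → ℂ}
    (hlim : ∀ᵐ θ ∂periodMeasure,
      Tendsto (fun r : ℝ => f (r * circleMap 0 1 θ)) (𝓝[<] 1) (𝓝 (F θ))) :
    Integrable F periodMeasure := by
  obtain ⟨hd, C, hC⟩ := hf
  obtain ⟨r, -, hr, hr1⟩ := exists_seq_strictMono_tendsto' (zero_lt_one (α := ℝ))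
  have hr2 : Tendsto r atTop (𝓝[<] 1) :=
    tendsto_nhdsWithin_iff.2 ⟨hr1, .of_forall fun n => (hr n).2⟩
  have hm : ∀ n, AEStronglyMeasurable (fun θ => f (r n * circleMap 0 1 θ)) periodMeasure :=
    fun n => (continuous_dilation_circleMap hd (hr n)).aestronglyMeasurable
  have hl : ∀ᵐ θ ∂periodMeasure,
      Tendsto (fun n => f (r n * circleMap 0 1 θ)) atTop (𝓝 (F θ)) := by
    filter_upwards [hlim] with θ hθ using hθ.comp hr2
  rw [← memLp_one_iff_integrable]
  refine ⟨aestronglyMeasurable_of_tendsto_ae _ hm hl, ?_⟩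
  refine (Lp.eLpNorm_le_of_ae_tendsto (C := ENNReal.ofReal (2 * π * C)) (.of_forall fun n => ?_) hm
    hl).trans_lt ENNReal.ofReal_lt_top
  rw [eLpNorm_one_eq_lintegral_enorm, ← ofReal_integral_norm_eq_lintegral_enorm
    (continuous_dilation_circleMap hd (hr n)).integrableOn_Ioc]
  refine ENNReal.ofReal_le_ofReal ?_
  have h1 := hC (r n) (hr n)
  rw [circleAverage_eq_integral_periodMeasure, smul_eq_mul, inv_mul_le_iff₀ two_pi_pos] at h1
  simpa [circleMap] using h1

/-! ### Real boundary values force real constants. -/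

theorem im_eq_zero_of_mem_RPow {p : ENNReal} (hp : 1 ≤ p) {f : ℂ → ℂ} (hf : f ∈ RPow p) {z : ℂ}
    (hz : z ∈ ball (0 : ℂ) 1) : (f z).im = 0 := by
  obtain ⟨⟨⟨-, hreal⟩, hS⟩, hH⟩ := hf
  have hH1 := mem_HFinite_one_of_mem_H hp hH
  obtain ⟨h, hd, hle, hC, ht⟩ := exists_multipliers_of_mem_smirnov hS
  -- Placing the existence of the limit as a premise lets `choose` give a boundary function on all
  -- of `ℝ`, arbitrary on the exceptional null set.
  have hex : ∀ θ : ℝ, ∃ x : ℝ,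
      (∃ x : ℝ, Tendsto (fun r : ℝ => f (r * circleMap 0 1 θ)) (𝓝[<] 1) (𝓝 (x : ℂ))) →
        Tendsto (fun r : ℝ => f (r * circleMap 0 1 θ)) (𝓝[<] 1) (𝓝 (x : ℂ)) := fun θ => by
    by_cases hx : ∃ x : ℝ,
        Tendsto (fun r : ℝ => f (r * circleMap 0 1 θ)) (𝓝[<] 1) (𝓝 (x : ℂ))
    · exact hx.imp fun x hx _ => hx
    · exact ⟨0, fun hx' => absurd hx' hx⟩
  choose x hx using hex
  have hlim : ∀ᵐ θ ∂periodMeasure,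
      Tendsto (fun r : ℝ => f (r * circleMap 0 1 θ)) (𝓝[<] 1) (𝓝 (x θ : ℂ)) := by
    filter_upwards [ae_restrict_of_ae hreal] with θ hθ using hx θ hθ
  rw [eq_integral_poissonKernel_of_multipliers hH1.1 hlim
    (integrable_boundary_of_mem_HFinite_one hH1 hlim) hd hle hC ht hz]
  -- Kernel and boundary values are both real, so the whole integral is the cast of a real one.
  simp_rw [Complex.real_smul, ← Complex.ofReal_mul, integral_complex_ofReal, ← Complex.ofReal_mul]
  exact Complex.ofReal_im _

theorem RPow_subset_RealConstants {p : ENNReal} (hp : 1 ≤ p) : RPow p ⊆ RealConstants := by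
  intro f hf
  have hd := (mem_HFinite_one_of_mem_H hp hf.2).1
  have him := fun z hz => im_eq_zero_of_mem_RPow hp hf (z := z) hz
  obtain ⟨c, hc⟩ := AnalyticOnNhd.eq_const_of_im_eq_const (c₀ := 0)
    (hd.analyticOnNhd isOpen_ball) him isOpen_ball
    (Metric.isConnected_ball one_pos)
  refine ⟨c.re, fun z hz => ?_⟩
  have h0 := him z hz
  rw [hc z hz] at h0 ⊢
  exact Complex.ext rfl (by simpa using h0)

/-! ### Real constants belong to every class. -/

theorem const_mem_HInfty {f : ℂ → ℂ} {c : ℂ} (hf : ∀ z ∈ ball (0 : ℂ) 1, f z = c) :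
    f ∈ HInfty :=
  ⟨(differentiableOn_const c).congr hf, ‖c‖, fun z hz => by rw [hf z hz]⟩

theorem one_mem_outer : (fun _ => 1 : ℂ → ℂ) ∈ Outer :=
  ⟨0, fun _ => 1, fun _ => zero_le_one, .of_forall fun _ => one_pos,
    by simp, fun z _ => by simp [circleAverage_const]⟩

theorem RealConstants_subset_RPow (p : ENNReal) : RealConstants ⊆ RPow p := by
  rintro f ⟨c, hf⟩
  have hInf := const_mem_HInfty hf
  have hone : (fun _ => 1 : ℂ → ℂ) ∈ HInfty := const_mem_HInfty fun _ _ => rfl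
  refine ⟨⟨⟨⟨f, hInf, fun _ => 1, hone, ⟨0, mem_ball_self one_pos, one_ne_zero⟩,
    fun z _ _ => by simp⟩, .of_forall fun θ => ⟨c, ?_⟩⟩,
    ⟨f, hInf, fun _ => 1, ⟨hone, one_mem_outer⟩, fun z _ => by simp⟩⟩, ?_⟩
  · refine tendsto_const_nhds.congr' ?_
    filter_upwards [Ioo_mem_nhdsLT one_pos] with r hr
    exact (hf _ (ofReal_mul_circleMap_mem_ball hr θ)).symm
  · unfold H
    split_ifs with htop
    · exact hInf
    · refine ⟨hInf.1, ‖(c : ℂ)‖ ^ p.toReal, fun r hr => le_of_eq ?_⟩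
      refine circleAverage_const_on_circle fun z hz => ?_
      rw [hf z (sphere_subset_ball (by rw [abs_of_pos hr.1]; exact hr.2) hz)]

end RealHardy

theorem theorem3p4 (p : ENNReal) (hp : 1 ≤ p) :
    RealHardy.RPow p = RealHardy.RealConstants :=
  (RealHardy.RPow_subset_RealConstants hp).antisymm (RealHardy.RealConstants_subset_RPow p)
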